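/- For nonzero integers $m,n$ let $B(m,n)=\langle a,b : a^{-1}b^{m}a=b^{n}\rangle$, and let $|\cdot|_a\colon B(m,n)\to\mathbb Z$ be the surjective homomorphism with $a\mapsto 1$, $b\mapsto 0$ (the exponent sum of $a$), whose kernel is the normal closure of $b$. For homomorphisms $\phi,\psi\colon G\to G$ of a group $G$, the coincidence Reidemeister number $R(\phi,\psi)$ is the number of equivalence classes of the relation on $G$ given by $\alpha\sim\psi(\tau)\,\alpha\,\phi(\tau)^{-1}$ $(\alpha,\tau\in G)$. **Theorem 7.1.** Let $m,n$ be integers with $|m|\neq|n|$ and $mn\neq 0$, and let $\phi,\psi\colon B(m,n)\to B(m,n)$ be injective endomorphisms. Then $\phi$ and $\psi$ both induce the identity on the quotient $\mathbb Z$, that is, $|\phi(x)|_a=|x|_a=|\psi(x)|_a$ for all $x\in B(m,n)$, and $R(\phi,\psi)=\infty$. -/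

import Mathlib

namespace BaumslagSolitar

/-- The word `a⁻¹ b ^ m a (b ^ n)⁻¹` in the free group on `a = of 0` and `b = of 1`. -/
def relator (m n : ℤ) : FreeGroup (Fin 2) :=
  (FreeGroup.of 0)⁻¹ * FreeGroup.of 1 ^ m * FreeGroup.of 0 * (FreeGroup.of 1 ^ n)⁻¹

/-- The group `B(m, n) = ⟨a, b : a⁻¹ b ^ m a = b ^ n⟩`. -/
abbrev B (m n : ℤ) : Type := PresentedGroup {relator m n}

/-- The values of the exponent sum of `a` on the generators: `a ↦ 1` and `b ↦ 0`, with `ℤ`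
written multiplicatively. -/
def genExpSum : Fin 2 → Multiplicative ℤ := ![Multiplicative.ofAdd 1, 1]

theorem lift_genExpSum_eq_one (m n : ℤ) :
    ∀ r ∈ ({relator m n} : Set (FreeGroup (Fin 2))), FreeGroup.lift genExpSum r = 1 := by
  rintro r rfl
  simp [relator, genExpSum]

/-- The projection `B(m, n) → ℤ` onto the quotient by the normal closure of `b`: it takes the
class of a word to the sum of the exponents of `a` in it. -/
def expSum (m n : ℤ) : B m n →* Multiplicative ℤ :=
  PresentedGroup.toGroup (lift_genExpSum_eq_one m n)

end BaumslagSolitar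

namespace Coincidence

variable {K G : Type*} [Group K] [Group G]

/-- The relation on `G` given by a pair of homomorphisms `f g : K →* G`:
`α ∼ g τ * α * (f τ)⁻¹` for `τ` in `K`. -/
def reidemeisterSetoid (f g : K →* G) : Setoid G where
  r α β := ∃ τ : K, β = g τ * α * (f τ)⁻¹
  iseqv :=
    { refl := fun α => ⟨1, by simp⟩
      symm := by
        rintro α β ⟨τ, rfl⟩
        exact ⟨τ⁻¹, by simp [mul_assoc]⟩
      trans := by
        rintro α β γ ⟨σ, rfl⟩ ⟨τ, rfl⟩
        exact ⟨τ * σ, by simp [mul_assoc]⟩ }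

/-- The coincidence Reidemeister number `R(f, g)`: the number, possibly `⊤`, of classes. -/
noncomputable def reidemeisterNumber (f g : K →* G) : ℕ∞ :=
  ENat.card (Quotient (reidemeisterSetoid f g))

end Coincidence

/-! An injective endomorphism sends `(a, b)` to a pair `(α, β)` with `α⁻¹ β ^ m α = β ^ n` and `β ≠
1`. Abelianizing, `m ≠ n` forces `β` to have exponent sum zero, so in the affine action on `ℚ`
(slope `m / n` for `a`, unit translation for `b`) `β` is a translation by some `t`. If `t ≠ 0`,
comparing both sides of the relation shows that the slope of `α` is `m / n`, so `α` has exponent sum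
one.

The action need not be faithful, so `t ≠ 0` needs a separate argument: `β ^ m` and `β ^ n` are
conjugate with `|m| ≠ |n|`, and in an HNN extension this forces `β` to be conjugate into the base
group (`exists_conj_of_of_conj_zpow`), hence to a nontrivial power of `b`.

Both endomorphisms thus preserve the exponent sum, which is then constant on Reidemeister classes
and takes infinitely many values. -/

namespace HNNExtension

/-! ### Length and cyclic reduction in HNN extensions. -/

open NormalWord

variable {G : Type*} [Group G] {A B : Subgroup G} {φ : A ≃* B}

/-- The product `t ^ u₁ * g₁ * ⋯ * t ^ uₖ * gₖ` of a list of pairs `(uᵢ, gᵢ)`. -/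
def listProd (φ : A ≃* B) (l : List (ℤˣ × G)) : HNNExtension G A B φ :=
  (l.map fun x => t ^ (x.1 : ℤ) * of x.2).prod

@[simp]
theorem listProd_nil : listProd φ [] = 1 := rfl

@[simp]
theorem listProd_cons (x : ℤˣ × G) (l : List (ℤˣ × G)) :
    listProd φ (x :: l) = t ^ (x.1 : ℤ) * of x.2 * listProd φ l := by
  simp [listProd]

@[simp]
theorem listProd_append (l l' : List (ℤˣ × G)) :
    listProd φ (l ++ l') = listProd φ l * listProd φ l' := by
  simp [listProd]

theorem listProd_flatten_replicate (l : List (ℤˣ × G)) (k : ℕ) :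
    listProd φ (List.replicate k l).flatten = listProd φ l ^ k := by
  induction k with
  | zero => simp
  | succ k ih => simp [List.replicate_succ, ih, pow_succ']

/-- No entry of the list cancels with the next one: the condition on the letters of a
`ReducedWord`. -/
abbrev IsReducedList (A B : Subgroup G) (l : List (ℤˣ × G)) : Prop :=
  l.IsChain (fun a b => a.2 ∈ toSubgroup A B a.1 → a.1 = b.1)

/-- The number of stable letters in the normal form of an element. -/
noncomputable def length (x : HNNExtension G A B φ) : ℕ :=
  (x • (empty : NormalWord (Classical.arbitrary (TransversalPair G A B)))).toList.length

theorem length_of_mul_listProd (g : G) {l : List (ℤˣ × G)} (hl : IsReducedList A B l) :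
    length (of g * listProd φ l) = l.length := by
  set d := Classical.arbitrary (TransversalPair G A B)
  obtain ⟨w, hw, hmap, -⟩ :=
    ReducedWord.exists_normalWord_prod_eq φ d (⟨g, l, hl⟩ : ReducedWord G A B)
  have h : w.prod φ = of g * listProd φ l := hw
  rw [length, ← h, prod_smul_empty]
  simpa using congrArg List.length hmap

theorem length_listProd {l : List (ℤˣ × G)} (hl : IsReducedList A B l) :
    length (listProd φ l) = l.length := by
  simpa using length_of_mul_listProd (φ := φ) 1 hl

theorem length_of (g : G) : length (of g : HNNExtension G A B φ) = 0 := by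
  simpa using length_of_mul_listProd (φ := φ) g (l := []) List.isChain_nil

theorem exists_eq_of_mul_listProd (x : HNNExtension G A B φ) :
    ∃ (g : G) (l : List (ℤˣ × G)), IsReducedList A B l ∧ x = of g * listProd φ l := by
  let w := NormalWord.equiv φ (Classical.arbitrary (TransversalPair G A B)) x
  exact ⟨w.head, w.toList, w.chain, ((NormalWord.equiv φ _).symm_apply_apply x).symm⟩

theorem length_unitsSMul_le {d : TransversalPair G A B} (u : ℤˣ) (w : NormalWord d) :
    (unitsSMul φ u w).toList.length ≤ w.toList.length + 1 := by
  rw [unitsSMul]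
  split_ifs with h
  · cases w using consRecOn with
    | ofGroup g => simp [Cancels] at h
    | cons g u' w h1 h2 =>
      simp only [unitsSMulWithCancel, consRecOn_cons, group_smul_toList, cons_toList,
        List.length_cons]
      omega
  · simp

theorem length_listProd_smul_le {d : TransversalPair G A B} (l : List (ℤˣ × G))
    (w : NormalWord d) :
    (listProd φ l • w).toList.length ≤ l.length + w.toList.length := by
  induction l with
  | nil => simp
  | cons a l ih =>
    rw [listProd_cons, mul_smul, mul_smul, t_pow_smul_eq_unitsSMul]
    refine (length_unitsSMul_le _ _).trans ?_
    rw [of_smul_eq_smul, group_smul_toList, List.length_cons]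
    omega

theorem length_mul_le (x y : HNNExtension G A B φ) : length (x * y) ≤ length x + length y := by
  obtain ⟨g, l, hl, rfl⟩ := exists_eq_of_mul_listProd x
  rw [length_of_mul_listProd g hl, length, mul_assoc, mul_smul, mul_smul, of_smul_eq_smul,
    group_smul_toList]
  exact length_listProd_smul_le l _

theorem zpow_mul_of_mul_zpow_neg (u : ℤˣ) (a : toSubgroup A B u) :
    t ^ (u : ℤ) * (of (a : G) : HNNExtension G A B φ) * t ^ (-(u : ℤ)) =
      of (toSubgroupEquiv φ u a : G) := by
  rcases Int.units_eq_one_or u with rfl | rfl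
  · rw [Units.val_one, zpow_one, zpow_neg_one]
    exact (equiv_eq_conj (φ := φ) a).symm
  · rw [Units.val_neg, Units.val_one, neg_neg, zpow_one, zpow_neg_one]
    exact (equiv_symm_eq_conj (φ := φ) a).symm

/-- Every element is conjugate to an element of the base group or to the product of a nonempty
cyclically reduced list. -/
theorem exists_conj_cyclicallyReduced (x : HNNExtension G A B φ) :
    (∃ (h : HNNExtension G A B φ) (g : G), x = h * of g * h⁻¹) ∨
    ∃ (h : HNNExtension G A B φ) (l : List (ℤˣ × G)), l ≠ [] ∧ IsReducedList A B (l ++ l) ∧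
      x = h * listProd φ l * h⁻¹ := by
  induction hn : length x using Nat.strong_induction_on generalizing x with
  | _ n ih =>
  obtain ⟨g, l, hl, rfl⟩ := exists_eq_of_mul_listProd x
  rw [length_of_mul_listProd g hl] at hn
  rcases List.eq_nil_or_concat' l with rfl | ⟨l', ⟨u, a⟩, rfl⟩
  · exact .inl ⟨1, g, by simp⟩
  -- Conjugating by `of g` moves the leading base element into the last letter.
  have hL : IsReducedList A B (l' ++ [(u, a * g)]) := by
    rw [IsReducedList, List.isChain_append] at hl ⊢
    refine ⟨hl.1, by simp, ?_⟩
    simpa using hl.2.2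
  have hx : of g * listProd φ (l' ++ [(u, a)]) =
      of g * listProd φ (l' ++ [(u, a * g)]) * (of g)⁻¹ := by
    simp [mul_assoc]
  rw [hx]
  by_cases hLL : IsReducedList A B ((l' ++ [(u, a * g)]) ++ (l' ++ [(u, a * g)]))
  · exact .inr ⟨of g, _, by simp, hLL, rfl⟩
  rcases l' with _ | ⟨⟨u₀, a₀⟩, l''⟩
  · exact absurd (by simp [IsReducedList]) hLL
  have hjoin : a * g ∈ toSubgroup A B u ∧ u ≠ u₀ := by
    by_contra hc
    refine hLL (List.isChain_append.2 ⟨hL, hL, ?_⟩)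
    rw [List.getLast?_concat]
    simpa using hc
  obtain ⟨hmem, hne⟩ := hjoin
  obtain rfl : u₀ = -u := by rw [← Int.units_ne_iff_eq_neg]; exact hne.symm
  have hl'' : IsReducedList A B l'' :=
    (List.isChain_append.1 (List.isChain_cons.1 hL).2).1
  -- The last and first letters cancel cyclically; conjugating by a stable letter removes both.
  set y : HNNExtension G A B φ :=
    of a₀ * listProd φ l'' * of (toSubgroupEquiv φ u ⟨a * g, hmem⟩ : G) with hy
  have hconj : listProd φ ((-u, a₀) :: l'' ++ [(u, a * g)]) =
      t ^ (-(u : ℤ)) * y * (t ^ (-(u : ℤ)))⁻¹ := by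
    rw [hy, ← zpow_mul_of_mul_zpow_neg]
    simp [mul_assoc]
  have hlen : length y < n := by
    have h1 := length_mul_le (of a₀ * listProd φ l'')
      (of (toSubgroupEquiv φ u ⟨a * g, hmem⟩ : G))
    rw [length_of_mul_listProd _ hl'', length_of] at h1
    simp only [List.length_append, List.length_cons, List.length_nil] at hn
    rw [← hy] at h1
    omega
  rw [hconj]
  rcases ih _ hlen y rfl with ⟨h, g', hg'⟩ | ⟨h, l, hl0, hl1, hl2⟩
  · refine .inl ⟨of g * t ^ (-(u : ℤ)) * h, g', ?_⟩
    rw [hg']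
    group
  · refine .inr ⟨of g * t ^ (-(u : ℤ)) * h, l, hl0, hl1, ?_⟩
    rw [hl2]
    group

theorem isReducedList_flatten_replicate {l : List (ℤˣ × G)} (hne : l ≠ [])
    (hl : IsReducedList A B (l ++ l)) (k : ℕ) :
    IsReducedList A B (List.replicate k l).flatten := by
  rw [IsReducedList, List.isChain_flatten (by
    intro h
    exact hne (List.eq_of_mem_replicate h).symm)]
  obtain ⟨h1, -, h2⟩ := List.isChain_append.1 hl
  refine ⟨fun l' hl' => List.eq_of_mem_replicate hl' ▸ h1, ?_⟩
  exact List.isChain_replicate_of_rel k h2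

/-- Cyclic reducedness means that nothing cancels where consecutive copies meet. -/
theorem length_listProd_pow {l : List (ℤˣ × G)} (hne : l ≠ [])
    (hl : IsReducedList A B (l ++ l)) (k : ℕ) :
    length (listProd φ l ^ k) = k * l.length := by
  rw [← listProd_flatten_replicate, length_listProd (isReducedList_flatten_replicate hne hl k)]
  simp

/-- Distinct positive powers of a cyclically reduced element containing a stable letter are not
conjugate. -/
theorem le_of_conj_pow_listProd {l : List (ℤˣ × G)} (hne : l ≠ [])
    (hl : IsReducedList A B (l ++ l)) {M N : ℕ} {c : HNNExtension G A B φ}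
    (h : listProd φ l ^ M = c * listProd φ l ^ N * c⁻¹) : M ≤ N := by
  by_contra! hlt
  -- Conjugation by `c` adds at most `length c + length c⁻¹`, a bound independent of the exponent.
  -- After raising to the power `j`, a gap between `M` and `N` exceeds it.
  set j := length c + length c⁻¹ + 1 with hj
  have hpow : listProd φ l ^ (M * j) = c * listProd φ l ^ (N * j) * c⁻¹ := by
    rw [pow_mul, pow_mul, h, conj_pow]
  have h1 := length_mul_le (c * listProd φ l ^ (N * j)) c⁻¹
  have h2 := length_mul_le c (listProd φ l ^ (N * j))
  rw [← hpow, length_listProd_pow hne hl] at h1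
  rw [length_listProd_pow hne hl] at h2
  have h3 : 0 < l.length := List.length_pos_iff.2 hne
  have h4 : (N + 1) * (j * l.length) ≤ M * (j * l.length) := Nat.mul_le_mul_right _ hlt
  have h5 : j ≤ j * l.length := Nat.le_mul_of_pos_right _ h3
  nlinarith

/-- An element with two powers of different absolute exponents which are conjugate is itself
conjugate to an element of the base group. -/
theorem exists_conj_of_of_conj_zpow {x c : HNNExtension G A B φ} {m n : ℤ} (hmn : |m| ≠ |n|)
    (h : x ^ m = c * x ^ n * c⁻¹) :
    ∃ (h : HNNExtension G A B φ) (g : G), x = h * of g * h⁻¹ := by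
  rcases exists_conj_cyclicallyReduced x with hx | ⟨k, l, hne, hl, rfl⟩
  · exact hx
  exfalso
  set y := listProd φ l
  have h1 : y ^ m = (k⁻¹ * c * k) * y ^ n * (k⁻¹ * c * k)⁻¹ := by
    rw [conj_zpow, conj_zpow] at h
    calc y ^ m = k⁻¹ * (k * y ^ m * k⁻¹) * k := by group
      _ = _ := by rw [h]; group
  set e := k⁻¹ * c * k
  -- Applying the relation twice makes both exponents squares, so signs disappear and natural powers
  -- suffice.
  have h2 : y ^ (m * m) = (e * e) * y ^ (n * n) * (e * e)⁻¹ := by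
    calc y ^ (m * m) = (y ^ m) ^ m := zpow_mul _ _ _
      _ = e * (y ^ m) ^ n * e⁻¹ := by
        nth_rw 1 [h1]
        rw [conj_zpow, ← zpow_mul, mul_comm n m, zpow_mul]
      _ = _ := by rw [h1, conj_zpow, ← zpow_mul]; group
  have hsq : ∀ z : ℤ, z * z = ((z.natAbs * z.natAbs : ℕ) : ℤ) := fun z => by simp
  have h3 : y ^ (m.natAbs * m.natAbs) = (e * e) * y ^ (n.natAbs * n.natAbs) * (e * e)⁻¹ := by
    rw [hsq, hsq, zpow_natCast, zpow_natCast] at h2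
    exact h2
  have h4 : y ^ (n.natAbs * n.natAbs) =
      (e * e)⁻¹ * y ^ (m.natAbs * m.natAbs) * ((e * e)⁻¹)⁻¹ := by
    rw [h3]; group
  have h5 := le_antisymm (le_of_conj_pow_listProd hne hl h3) (le_of_conj_pow_listProd hne hl h4)
  rw [Nat.mul_self_inj] at h5
  exact hmn (by rw [Int.abs_eq_natAbs, Int.abs_eq_natAbs, h5])

end HNNExtension

/-! ### The affine action and the HNN description of `B(m, n)`. -/

namespace BaumslagSolitar

variable {m n : ℤ}

theorem conj_relation (m n : ℤ) :
    (PresentedGroup.of 0 : B m n)⁻¹ * PresentedGroup.of 1 ^ m * PresentedGroup.of 0 =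
      PresentedGroup.of 1 ^ n := by
  have h : PresentedGroup.mk {relator m n} (relator m n) = 1 :=
    PresentedGroup.one_of_mem (Set.mem_singleton _)
  exact mul_inv_eq_one.1 h

@[simp]
theorem expSum_of_zero : expSum m n (PresentedGroup.of 0) = Multiplicative.ofAdd 1 :=
  PresentedGroup.toGroup.of _

@[simp]
theorem expSum_of_one : expSum m n (PresentedGroup.of 1) = 1 :=
  PresentedGroup.toGroup.of _

/-- The homomorphism out of `B(m, n)` given by two elements satisfying its relation. -/
def lift {H : Type*} [Group H] (a b : H) (h : a⁻¹ * b ^ m * a = b ^ n) : B m n →* H :=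
  PresentedGroup.toGroup (f := ![a, b]) (by
    rintro r rfl
    simpa [relator, mul_inv_eq_one] using h)

@[simp]
theorem lift_of_zero {H : Type*} [Group H] (a b : H) (h : a⁻¹ * b ^ m * a = b ^ n) :
    lift a b h (PresentedGroup.of 0) = a :=
  PresentedGroup.toGroup.of _

@[simp]
theorem lift_of_one {H : Type*} [Group H] (a b : H) (h : a⁻¹ * b ^ m * a = b ^ n) :
    lift a b h (PresentedGroup.of 1) = b :=
  PresentedGroup.toGroup.of _

theorem hom_ext {H : Type*} [Group H] {f g : B m n →* H}
    (h0 : f (PresentedGroup.of 0) = g (PresentedGroup.of 0))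
    (h1 : f (PresentedGroup.of 1) = g (PresentedGroup.of 1)) : f = g := by
  refine PresentedGroup.ext fun i => ?_
  fin_cases i
  exacts [h0, h1]

theorem addRight_one_zpow (k : ℤ) :
    (Equiv.addRight (1 : ℚ)) ^ k = Equiv.addRight (k : ℚ) := by
  simp

/-- The action of `B(m, n)` on `ℚ` by affine maps: `a` multiplies by `m / n` and `b` adds `1`. -/
def affineAction (hm : m ≠ 0) (hn : n ≠ 0) : B m n →* Equiv.Perm ℚ :=
  lift (Equiv.mulRight₀ ((m : ℚ) / n) (by positivity)) (Equiv.addRight 1) (by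
    rw [mul_assoc, inv_mul_eq_iff_eq_mul, addRight_one_zpow, addRight_one_zpow]
    ext x
    have : (n : ℚ) ≠ 0 := by exact_mod_cast hn
    simp
    field_simp)

/-- The slope is multiplicative, so checking generators suffices; this lets the exponent sum be read
off the action. -/
theorem affineAction_apply (hm : m ≠ 0) (hn : n ≠ 0) (g : B m n) :
    ∃ c : ℚ, ∀ x, affineAction hm hn g x =
      ((m : ℚ) / n) ^ (Multiplicative.toAdd (expSum m n g)) * x + c := by
  have hr : (m : ℚ) / n ≠ 0 := by positivity
  let S : Subgroup (B m n) :=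
    { carrier := {g | ∃ c : ℚ, ∀ x, affineAction hm hn g x =
        ((m : ℚ) / n) ^ (Multiplicative.toAdd (expSum m n g)) * x + c}
      one_mem' := ⟨0, by simp⟩
      mul_mem' := by
        rintro g h ⟨c, hc⟩ ⟨d, hd⟩
        refine ⟨((m : ℚ) / n) ^ (Multiplicative.toAdd (expSum m n g)) * d + c, fun x => ?_⟩
        rw [map_mul, Equiv.Perm.mul_apply, hd, hc, map_mul, toAdd_mul, zpow_add₀ hr]
        ring
      inv_mem' := by
        rintro g ⟨c, hc⟩
        refine ⟨-(((m : ℚ) / n) ^ (-Multiplicative.toAdd (expSum m n g)) * c), fun x => ?_⟩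
        rw [map_inv, Equiv.Perm.inv_eq_iff_eq, hc, map_inv, toAdd_inv, zpow_neg]
        have := zpow_ne_zero (Multiplicative.toAdd (expSum m n g)) hr
        field_simp
        ring }
  refine PresentedGroup.generated_by _ S (fun i => ?_) g
  fin_cases i
  · refine ⟨0, fun x => ?_⟩
    simp [affineAction, mul_comm]
  · refine ⟨1, fun x => ?_⟩
    simp [affineAction]

theorem affineAction_of_one_zpow (hm : m ≠ 0) (hn : n ≠ 0) (k : ℤ) (x : ℚ) :
    affineAction hm hn (PresentedGroup.of 1 ^ k) x = x + k := by
  rw [map_zpow, affineAction, lift_of_one, addRight_one_zpow]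
  simp

theorem zpowersHom_ofAdd_injective {k : ℤ} (hk : k ≠ 0) :
    Function.Injective (zpowersHom (Multiplicative ℤ) (Multiplicative.ofAdd k)) := by
  intro x y h
  have : Multiplicative.toAdd x * k = Multiplicative.toAdd y * k := by
    rw [zpowersHom_apply, zpowersHom_apply, ← ofAdd_zsmul, ← ofAdd_zsmul] at h
    exact Multiplicative.ofAdd.injective h
  exact Multiplicative.toAdd.injective (mul_right_cancel₀ hk this)

/-- The isomorphism `m ℤ ≃ n ℤ` taking `m` to `n`. -/
noncomputable def multiplesEquiv (hm : m ≠ 0) (hn : n ≠ 0) :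
    (zpowersHom (Multiplicative ℤ) (Multiplicative.ofAdd m)).range ≃*
      (zpowersHom (Multiplicative ℤ) (Multiplicative.ofAdd n)).range :=
  (MonoidHom.ofInjective (zpowersHom_ofAdd_injective hm)).symm.trans
    (MonoidHom.ofInjective (zpowersHom_ofAdd_injective hn))

theorem exists_eq_and_multiplesEquiv_eq (hm : m ≠ 0) (hn : n ≠ 0)
    (a : (zpowersHom (Multiplicative ℤ) (Multiplicative.ofAdd m)).range) :
    ∃ k : ℤ, (a : Multiplicative ℤ) = Multiplicative.ofAdd (k * m) ∧
      (multiplesEquiv hm hn a : Multiplicative ℤ) = Multiplicative.ofAdd (k * n) := by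
  obtain ⟨k, rfl⟩ := (MonoidHom.ofInjective (zpowersHom_ofAdd_injective hm)).surjective a
  refine ⟨Multiplicative.toAdd k, ?_, ?_⟩
  · rw [MonoidHom.ofInjective_apply, zpowersHom_apply, ← ofAdd_zsmul, smul_eq_mul]
  · rw [multiplesEquiv, MulEquiv.trans_apply, MulEquiv.symm_apply_apply,
      MonoidHom.ofInjective_apply, zpowersHom_apply, ← ofAdd_zsmul, smul_eq_mul]

theorem t_mul_of_ofAdd (hm : m ≠ 0) (hn : n ≠ 0) :
    (HNNExtension.t * HNNExtension.of (Multiplicative.ofAdd m) :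
      HNNExtension (Multiplicative ℤ) _ _ (multiplesEquiv hm hn)) =
      HNNExtension.of (Multiplicative.ofAdd n) * HNNExtension.t := by
  have hmem : Multiplicative.ofAdd m ∈
      (zpowersHom (Multiplicative ℤ) (Multiplicative.ofAdd m)).range :=
    ⟨Multiplicative.ofAdd 1, zpow_one _⟩
  have h := HNNExtension.t_mul_of (φ := multiplesEquiv hm hn) ⟨_, hmem⟩
  obtain ⟨k, h1, h2⟩ := exists_eq_and_multiplesEquiv_eq hm hn ⟨_, hmem⟩
  obtain rfl : k = 1 := by
    have : m = k * m := Multiplicative.ofAdd.injective h1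
    exact mul_right_cancel₀ hm (by rw [← this, one_mul])
  rw [h2, one_mul] at h
  exact h

theorem of_ofAdd_one_zpow {A B : Subgroup (Multiplicative ℤ)} (φ : A ≃* B) (k : ℤ) :
    (HNNExtension.of (Multiplicative.ofAdd 1) : HNNExtension _ A B φ) ^ k =
      HNNExtension.of (Multiplicative.ofAdd k) := by
  rw [← map_zpow, ← ofAdd_zsmul, smul_eq_mul, mul_one]

/-- The homomorphism from `B(m, n)` to the HNN extension of `ℤ` by `m ℤ ≃ n ℤ`. The stable letter
of the latter is the inverse of `a`. -/
noncomputable def toHNN (hm : m ≠ 0) (hn : n ≠ 0) :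
    B m n →* HNNExtension (Multiplicative ℤ) _ _ (multiplesEquiv hm hn) :=
  lift HNNExtension.t⁻¹ (HNNExtension.of (Multiplicative.ofAdd 1)) (by
    rw [of_ofAdd_one_zpow, of_ofAdd_one_zpow, inv_inv, t_mul_of_ofAdd, mul_inv_cancel_right])

/-- The homomorphism from the HNN extension of `ℤ` by `m ℤ ≃ n ℤ` to `B(m, n)`. -/
noncomputable def ofHNN (hm : m ≠ 0) (hn : n ≠ 0) :
    HNNExtension (Multiplicative ℤ) _ _ (multiplesEquiv hm hn) →* B m n :=
  HNNExtension.lift (zpowersHom (B m n) (PresentedGroup.of 1)) (PresentedGroup.of 0)⁻¹ (by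
    intro a
    obtain ⟨k, h1, h2⟩ := exists_eq_and_multiplesEquiv_eq hm hn a
    rw [h1, h2, zpowersHom_apply, zpowersHom_apply, toAdd_ofAdd, toAdd_ofAdd, mul_comm k n,
      zpow_mul _ n k, ← conj_relation, mul_comm k m, zpow_mul]
    have := conj_zpow (a := (PresentedGroup.of 0 : B m n)⁻¹)
      (b := PresentedGroup.of 1 ^ m) (i := k)
    rw [inv_inv] at this
    rw [this]
    group)

/-- This one-sided inverse is enough to carry conjugacy into the base group back to `B m n`. -/
theorem ofHNN_comp_toHNN (hm : m ≠ 0) (hn : n ≠ 0) :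
    (ofHNN hm hn).comp (toHNN hm hn) = MonoidHom.id _ := by
  apply hom_ext
  · simp [ofHNN, toHNN]
  · simp [ofHNN, toHNN]

/-- If powers of `x` with exponents `m` and `n`, `|m| ≠ |n|`, are conjugate, then `x` is conjugate
to a power of `b`. -/
theorem exists_conj_zpow_of_conj_zpow (hm : m ≠ 0) (hn : n ≠ 0) {x c : B m n} {p q : ℤ}
    (hpq : |p| ≠ |q|) (h : x ^ p = c * x ^ q * c⁻¹) :
    ∃ (g : B m n) (s : ℤ), x = g * PresentedGroup.of 1 ^ s * g⁻¹ := by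
  have h' : toHNN hm hn x ^ p = toHNN hm hn c * toHNN hm hn x ^ q * (toHNN hm hn c)⁻¹ := by
    simpa using congrArg (toHNN hm hn) h
  obtain ⟨k, g, hx⟩ := HNNExtension.exists_conj_of_of_conj_zpow hpq h'
  refine ⟨ofHNN hm hn k, Multiplicative.toAdd g, ?_⟩
  have hid : ofHNN hm hn (toHNN hm hn x) = x := DFunLike.congr_fun (ofHNN_comp_toHNN hm hn) x
  rw [← hid, hx]
  simp [ofHNN, zpowersHom_apply]

/-- In a solution of the relation of `B(m, n)` the element in the place of `b` has exponent sum
zero. -/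
theorem expSum_eq_one_of_relation (hmn : m ≠ n) {α β : B m n}
    (h : α⁻¹ * β ^ m * α = β ^ n) : expSum m n β = 1 := by
  have h1 := congrArg (fun x => Multiplicative.toAdd (expSum m n x)) h
  simp only [map_mul, map_inv, map_zpow, toAdd_mul, toAdd_inv, toAdd_zpow, smul_eq_mul] at h1
  have h2 : (m - n) * Multiplicative.toAdd (expSum m n β) = 0 := by linarith
  rcases mul_eq_zero.1 h2 with h3 | h3
  · exact absurd (sub_eq_zero.1 h3) hmn
  · exact Multiplicative.toAdd.injective h3

theorem eq_one_of_div_zpow_eq (hmn : |m| ≠ |n|) (hm : m ≠ 0) (hn : n ≠ 0) {k : ℤ}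
    (h : ((m : ℚ) / n) ^ k = (m : ℚ) / n) : k = 1 := by
  have hr : (m : ℚ) / n ≠ 0 := by positivity
  have h1 : ((m : ℚ) / n) ^ (k - 1) = 1 := by
    rw [zpow_sub_one₀ hr, h, mul_inv_cancel₀ hr]
  have h2 : |(m : ℚ) / n| ^ (k - 1) = 1 := by rw [← abs_zpow, h1, abs_one]
  have hne : |(m : ℚ) / n| ≠ 1 := by
    rw [abs_div, Ne, div_eq_one_iff_eq (by positivity)]
    exact_mod_cast hmn
  have := (zpow_eq_one_iff_right₀ (abs_nonneg _) hne).1 h2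
  omega

/-- In a solution of the relation of `B(m, n)` with nontrivial element in the place of `b`, the
element in the place of `a` has exponent sum one. -/
theorem expSum_eq_ofAdd_one_of_relation (hmn : |m| ≠ |n|) (hm : m ≠ 0) (hn : n ≠ 0)
    {α β : B m n} (h : α⁻¹ * β ^ m * α = β ^ n) (hβ : β ≠ 1) :
    expSum m n α = Multiplicative.ofAdd 1 := by
  have hβ0 := expSum_eq_one_of_relation (fun e => hmn (by rw [e])) h
  obtain ⟨t, ht⟩ := affineAction_apply hm hn β
  obtain ⟨c, hc⟩ := affineAction_apply hm hn α
  simp only [hβ0, toAdd_one, zpow_zero, one_mul] at ht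
  have hβt : affineAction hm hn β = Equiv.addRight t := Equiv.ext ht
  have hzpow : ∀ (k : ℤ) (x : ℚ), affineAction hm hn (β ^ k) x = x + k * t := by
    intro k x
    rw [map_zpow, hβt]
    simp
  -- A conjugate of `b ^ s` acting trivially forces `s = 0`, since `b ^ s` translates by `s`.
  have ht0 : t ≠ 0 := by
    rintro rfl
    obtain ⟨g, s, rfl⟩ := exists_conj_zpow_of_conj_zpow hm hn (c := α) hmn
      (by rw [← h]; group)
    have h1 : affineAction hm hn (PresentedGroup.of 1 ^ s) = 1 := by
      have : affineAction hm hn (g * PresentedGroup.of 1 ^ s * g⁻¹) = 1 := by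
        rw [hβt]; ext; simp
      simpa using this
    have h2 := affineAction_of_one_zpow hm hn s 0
    rw [h1] at h2
    have h3 : s = 0 := by simpa using h2.symm
    exact hβ (by simp [h3])
  have h1 : β ^ m * α = α * β ^ n := by rw [← h]; group
  -- With `k` the exponent sum of `α`, evaluation at `0` gives `c + m t = (m / n) ^ k * n t + c`.
  have h2 := congrArg (fun g => affineAction hm hn g 0) h1
  simp only [map_mul, Equiv.Perm.mul_apply, hzpow, hc] at h2
  have hn' : (n : ℚ) ≠ 0 := by exact_mod_cast hn
  have h3 : ((m : ℚ) / n) ^ (Multiplicative.toAdd (expSum m n α)) = (m : ℚ) / n := by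
    rw [eq_div_iff hn']
    refine mul_right_cancel₀ ht0 ?_
    linarith
  exact Multiplicative.toAdd.injective (eq_one_of_div_zpow_eq hmn hm hn h3)

theorem of_one_ne_one (hm : m ≠ 0) (hn : n ≠ 0) : (PresentedGroup.of 1 : B m n) ≠ 1 := by
  intro h
  have := affineAction_of_one_zpow hm hn 1 0
  simp [h] at this

/-- Injectivity enters only through `φ(b) ≠ 1`. -/
theorem expSum_comp_eq_of_injective (hmn : |m| ≠ |n|) (hm : m ≠ 0) (hn : n ≠ 0)
    (φ : B m n →* B m n) (hφ : Function.Injective φ) :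
    (expSum m n).comp φ = expSum m n := by
  have h : (φ (PresentedGroup.of 0))⁻¹ * φ (PresentedGroup.of 1) ^ m * φ (PresentedGroup.of 0) =
      φ (PresentedGroup.of 1) ^ n := by
    simpa using congrArg φ (conj_relation m n)
  apply hom_ext
  · rw [MonoidHom.comp_apply, expSum_of_zero]
    refine expSum_eq_ofAdd_one_of_relation hmn hm hn h ?_
    rw [Ne, map_eq_one_iff φ hφ]
    exact of_one_ne_one hm hn
  · rw [MonoidHom.comp_apply, expSum_of_one]
    exact expSum_eq_one_of_relation (fun e => hmn (by rw [e])) h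

end BaumslagSolitar

/-! ### Infinite Reidemeister numbers from abelian quotients. -/

namespace Coincidence

/-- If `f` and `g` agree after composition with a homomorphism onto an infinite commutative
group, then their coincidence Reidemeister number is infinite. -/
theorem reidemeisterNumber_eq_top {K G H : Type*} [Group K] [Group G] [CommGroup H] [Infinite H]
    {f g : K →* G} (p : G →* H) (hp : Function.Surjective p) (h : p.comp f = p.comp g) :
    reidemeisterNumber f g = ⊤ := by
  -- As `H` is commutative, the factors `p (g τ)` and `p (f τ)⁻¹` cancel.
  let q : Quotient (reidemeisterSetoid f g) → H := Quotient.lift p (by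
    rintro α β ⟨τ, rfl⟩
    have : p (f τ) = p (g τ) := DFunLike.congr_fun h τ
    simp [this])
  have hq : Function.Surjective q := fun y => by
    obtain ⟨x, rfl⟩ := hp y
    exact ⟨Quotient.mk _ x, rfl⟩
  have := Infinite.of_surjective q hq
  exact ENat.card_eq_top_of_infinite

end Coincidence

theorem theorem7p1 (m n : ℤ) (hmn : |m| ≠ |n|) (h0 : m * n ≠ 0)
    (φ ψ : BaumslagSolitar.B m n →* BaumslagSolitar.B m n)
    (hφ : Function.Injective φ) (hψ : Function.Injective ψ) :
    (BaumslagSolitar.expSum m n).comp φ = BaumslagSolitar.expSum m n ∧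
    (BaumslagSolitar.expSum m n).comp ψ = BaumslagSolitar.expSum m n ∧
    Coincidence.reidemeisterNumber φ ψ = ⊤ := by
  have hm := left_ne_zero_of_mul h0
  have hn := right_ne_zero_of_mul h0
  have h1 := BaumslagSolitar.expSum_comp_eq_of_injective hmn hm hn φ hφ
  have h2 := BaumslagSolitar.expSum_comp_eq_of_injective hmn hm hn ψ hψ
  refine ⟨h1, h2, Coincidence.reidemeisterNumber_eq_top (BaumslagSolitar.expSum m n) (fun y => ?_)
    (h1.trans h2.symm)⟩
  exact ⟨PresentedGroup.of 0 ^ Multiplicative.toAdd y, by simp [← ofAdd_zsmul]⟩
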